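/- There is an absolute constant $C>0$ such that the following holds. Let $m,n\ge 1$ be integers, let $M$ be an $m\times n$ Boolean matrix (a matrix all of whose entries are $0$ or $1$), and let $\gamma$ be a real number with $$\frac{\|M\|_{\mathrm{tr}}}{\sqrt{mn}}\le\gamma ,$$ where the trace norm $\|M\|_{\mathrm{tr}}$ is the sum of the $\min\{m,n\}$ singular values of $M$. Then there are real numbers $$\delta_1,\delta_2\ \ge\ 2^{-C\max\{1,\gamma\}^3}$$ such that $M$ contains an all-zeros or all-ones submatrix of size $\delta_1 m\times\delta_2 n$; that is, there are a set $A$ of exactly $\delta_1 m$ rows and a set $B$ of exactly $\delta_2 n$ columns such that either $M_{i,j}=0$ for all $(i,j)\in A\times B$, or $M_{i,j}=1$ for all $(i,j)\in A\times B$. -/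

import Mathlib

/-- A real matrix is Boolean if all of its entries are `0` or `1`. -/
def Matrix.IsBoolean {m n : ℕ} (M : Matrix (Fin m) (Fin n) ℝ) : Prop :=
  ∀ i j, M i j = 0 ∨ M i j = 1

/-- The trace norm of an `m × n` real matrix: the sum of its `min m n` singular values.
Here `M` is regarded as a linear map from `ℝⁿ` to `ℝᵐ` with the Euclidean inner products, and
`LinearMap.singularValues` lists the singular values in decreasing order, starting from
index `0`. -/
noncomputable def Matrix.traceNorm {m n : ℕ} (M : Matrix (Fin m) (Fin n) ℝ) : ℝ :=
  ∑ i ∈ Finset.range (min m n), (Matrix.toEuclideanLin M).singularValues i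

/-- The normalized trace norm of an `m × n` real matrix. -/
noncomputable def Matrix.normalizedTraceNorm {m n : ℕ} (M : Matrix (Fin m) (Fin n) ℝ) : ℝ :=
  M.traceNorm / Real.sqrt ((m : ℝ) * (n : ℝ))

/-!
The singular value decomposition writes the Boolean matrix as `M i j = ⟪u i, v j⟫`, where after
rescaling both the `u i` and the `v j` have mean squared norm at most `γ` (from now on `1 ≤ γ`).
With `R = 6 γ` and `c = 32 R`, give each vector `x` the weight `exp (-c ‖x‖ ^ 2)`, and let the
potential be the product of the total weight of the rows and that of the columns. At the start it
is at least `m n exp (-16 R ^ 2)`, even after the vectors of squared norm above `R` are discarded.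
As long as `M` does not vanish on the current rows and columns, one of two moves applies, and
neither decreases the potential.

* *Projecting.* For a row `i₀`, delete the columns `j` with `M i₀ j = 1`. The remaining `v j` are
  orthogonal to `u i₀`, so all `u i` may be replaced by their projections onto the orthogonal
  complement of `u i₀`, which are shorter. If `p` is the weighted density of row `i₀` and `q` the
  weighted mean of `⟪u i, u i₀⟫ ^ 2`, the potential changes by a factor of at least
  `(1 + 32 q) (1 - p)`, which is at least `1` when `p ≤ 15 / 16` and `p ≤ 2 q`
  (`exists_expMass_mul_le_of_project`). By the Cauchy–Schwarz inequality `sq_sum_sq_inner_le` for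
  second moment operators, the mean of `q` over the rows, or its analogue for the columns, is at
  least the overall density, so such a row or column exists unless rows or columns that are more
  than `15 / 16` dense carry a proportion `1 / (9 R ^ 2)` of the weight
  (`exists_inner_col_le_two_mul_inner_row`).
* *Complementing.* In the latter case restrict to the dense rows or columns. If `a` and `b` are the
  weighted means of the `u i` and the `v j`, then `⟪a, b⟫ ≥ 15 / 16`, and `1 - M` is represented by
  `-(u i - a)` and `v j - b` up to small correction terms, which two more coordinates absorb. On
  average the squared norms drop by a constant in total, and by Jensen's inequality this multiplies
  the potential by a factor exponential in `R`, which outweighs the restriction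
  (`exists_inner_eq_one_sub`, `exists_complement`).

Each complementation at least doubles the potential, which never exceeds `m n`, and each projection
turns a nonzero vector into zero; so the process ends, at a rectangle on which `M` or `1 - M`
vanishes (`exists_monochromatic_of_expMass`). The weights are at most `1`, so the area of this
rectangle is at least the potential, hence at least `m n exp (-576 γ ^ 2)`, and
`576 γ ^ 2 ≤ 1000 (log 2) γ ^ 3`.
-/

/-! ### Two inequalities for weighted families -/

theorem sum_sq_inner_eq_inner_sum_tmul {α β E : Type*} [NormedAddCommGroup E]
    [InnerProductSpace ℝ E] (s : Finset α) (t : Finset β) (a : α → ℝ) (b : β → ℝ) (x : α → E)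
    (y : β → E) : ∑ i ∈ s, ∑ j ∈ t, a i * b j * inner ℝ (x i) (y j) ^ 2 =
      inner ℝ (∑ i ∈ s, (a i • x i) ⊗ₜ[ℝ] x i) (∑ j ∈ t, (b j • y j) ⊗ₜ[ℝ] y j) := by
  rw [sum_inner]
  refine Finset.sum_congr rfl fun i _ => ?_
  rw [inner_sum]
  refine Finset.sum_congr rfl fun j _ => ?_
  rw [TensorProduct.inner_tmul, real_inner_smul_left, real_inner_smul_right]
  ring

/-- The Cauchy–Schwarz inequality for the Frobenius inner product of the second moment operators
`∑ aᵢ xᵢ ⊗ xᵢ` and `∑ bⱼ yⱼ ⊗ yⱼ`. -/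
theorem sq_sum_sq_inner_le {α β E : Type*} [NormedAddCommGroup E] [InnerProductSpace ℝ E]
    (s : Finset α) (t : Finset β) (a : α → ℝ) (b : β → ℝ) (x : α → E) (y : β → E) :
    (∑ i ∈ s, ∑ j ∈ t, a i * b j * inner ℝ (x i) (y j) ^ 2) ^ 2 ≤
      (∑ i ∈ s, ∑ i' ∈ s, a i * a i' * inner ℝ (x i) (x i') ^ 2) *
        ∑ j ∈ t, ∑ j' ∈ t, b j * b j' * inner ℝ (y j) (y j') ^ 2 := by
  rw [sum_sq_inner_eq_inner_sum_tmul, sum_sq_inner_eq_inner_sum_tmul,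
    sum_sq_inner_eq_inner_sum_tmul, sq]
  exact real_inner_mul_inner_self_le (F := TensorProduct ℝ E E) _ _

/-- Jensen's inequality for the exponential function, with unnormalized weights. -/
theorem exp_mul_sum_le_sum_mul_exp {α : Type*} (s : Finset α) (w f : α → ℝ) (t : ℝ)
    (hw : ∀ i ∈ s, 0 ≤ w i) (ht : t * ∑ i ∈ s, w i ≤ ∑ i ∈ s, w i * f i) :
    Real.exp t * ∑ i ∈ s, w i ≤ ∑ i ∈ s, w i * Real.exp (f i) := by
  have h1 : ∑ i ∈ s, w i * (Real.exp t * (1 + f i - t)) ≤ ∑ i ∈ s, w i * Real.exp (f i) := by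
    refine Finset.sum_le_sum fun i hi => mul_le_mul_of_nonneg_left ?_ (hw i hi)
    have h2 := Real.add_one_le_exp (f i - t)
    calc Real.exp t * (1 + f i - t) ≤ Real.exp t * Real.exp (f i - t) := by
          gcongr
          linarith
      _ = Real.exp (f i) := by rw [← Real.exp_add]; ring_nf
  have h2 : ∑ i ∈ s, w i * (Real.exp t * (1 + f i - t)) =
      Real.exp t * (∑ i ∈ s, w i + (∑ i ∈ s, w i * f i - t * ∑ i ∈ s, w i)) := by
    rw [Finset.mul_sum s w t, ← Finset.sum_sub_distrib, ← Finset.sum_add_distrib, Finset.mul_sum]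
    exact Finset.sum_congr rfl fun i _ => by ring
  rw [h2] at h1
  refine le_trans ?_ h1
  gcongr
  linarith

/-! ### Choosing a vector to project away -/

/-- If few rows are dense, then some row vector `x i` that is not dense is at least half as
correlated with the row vectors as it is with the column vectors, provided that the second moment
of the rows is at least the density. -/
theorem exists_inner_col_le_two_mul_inner_row {α β E : Type*} [NormedAddCommGroup E]
    [InnerProductSpace ℝ E] (s : Finset α) (t : Finset β) (a : α → ℝ) (b : β → ℝ)
    (x : α → E) (y : β → E) {R : ℝ} (hR : 0 < R) (ha : ∀ i ∈ s, 0 ≤ a i) (hb : ∀ j ∈ t, 0 ≤ b j)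
    (hx : ∀ i ∈ s, ‖x i‖ ^ 2 ≤ R)
    (hdense : ∑ i ∈ s with 15 / 16 < ∑ j ∈ t, b j * inner ℝ (x i) (y j) ^ 2, a i ≤ 1 / (9 * R ^ 2))
    (hpos : 0 < ∑ i ∈ s, ∑ j ∈ t, a i * b j * inner ℝ (x i) (y j) ^ 2)
    (hle : ∑ i ∈ s, ∑ j ∈ t, a i * b j * inner ℝ (x i) (y j) ^ 2 ≤
      ∑ i ∈ s, ∑ i' ∈ s, a i * a i' * inner ℝ (x i) (x i') ^ 2) :
    ∃ i ∈ s, x i ≠ 0 ∧ ∑ j ∈ t, b j * inner ℝ (x i) (y j) ^ 2 ≤ 15 / 16 ∧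
      ∑ j ∈ t, b j * inner ℝ (x i) (y j) ^ 2 ≤ 2 * ∑ i' ∈ s, a i' * inner ℝ (x i) (x i') ^ 2 := by
  classical
  by_contra! hcon
  set p : α → ℝ := fun i => ∑ j ∈ t, b j * inner ℝ (x i) (y j) ^ 2 with hp
  set q : α → ℝ := fun i => ∑ i' ∈ s, a i' * inner ℝ (x i) (x i') ^ 2 with hq
  set d := s.filter fun i => 15 / 16 < p i with hd
  have hP : ∑ i ∈ s, ∑ j ∈ t, a i * b j * inner ℝ (x i) (y j) ^ 2 = ∑ i ∈ s, a i * p i := by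
    refine Finset.sum_congr rfl fun i _ => ?_
    rw [hp, Finset.mul_sum]
    exact Finset.sum_congr rfl fun j _ => by ring
  have hX : ∀ r : Finset α, ∑ i ∈ r, ∑ i' ∈ s, a i * a i' * inner ℝ (x i) (x i') ^ 2 =
      ∑ i ∈ r, a i * q i := by
    intro r
    refine Finset.sum_congr rfl fun i _ => ?_
    rw [hq, Finset.mul_sum]
    exact Finset.sum_congr rfl fun j _ => by ring
  have hp0 : ∀ i, 0 ≤ p i := fun i =>
    Finset.sum_nonneg fun j hj => mul_nonneg (hb j hj) (sq_nonneg _)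
  have hds : d ⊆ s := Finset.filter_subset _ _
  have hcs := sq_sum_sq_inner_le d s a a x x
  have hbb : ∑ i ∈ d, ∑ i' ∈ d, a i * a i' * inner ℝ (x i) (x i') ^ 2 ≤
      (∑ i ∈ d, a i) ^ 2 * R ^ 2 := by
    rw [sq (∑ i ∈ d, a i), Finset.sum_mul_sum, Finset.sum_mul]
    refine Finset.sum_le_sum fun i hi => ?_
    rw [Finset.sum_mul]
    refine Finset.sum_le_sum fun j hj => ?_
    refine mul_le_mul_of_nonneg_left ?_ (mul_nonneg (ha i (hds hi)) (ha j (hds hj)))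
    calc inner ℝ (x i) (x j) ^ 2 ≤ (‖x i‖ * ‖x j‖) ^ 2 := by
          rw [← sq_abs]
          gcongr
          exact abs_real_inner_le_norm _ _
      _ = ‖x i‖ ^ 2 * ‖x j‖ ^ 2 := by ring
      _ ≤ R * R := mul_le_mul (hx i (hds hi)) (hx j (hds hj)) (sq_nonneg _) hR.le
      _ = R ^ 2 := by ring
  rw [hX, hX] at hcs
  rw [hP] at hpos hle
  rw [hX] at hle
  have hsplit : ∀ f : α → ℝ, ∑ i ∈ s, f i = ∑ i ∈ d, f i + ∑ i ∈ s with ¬ 15 / 16 < p i, f i :=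
    fun f => (Finset.sum_filter_add_sum_filter_not s _ f).symm
  -- the rows that are not dense contribute at most half of the density to the second moment
  have hgood : ∑ i ∈ s with ¬ 15 / 16 < p i, a i * q i ≤
      (∑ i ∈ s with ¬ 15 / 16 < p i, a i * p i) / 2 := by
    rw [Finset.sum_div]
    refine Finset.sum_le_sum fun i hi => ?_
    rw [Finset.mem_filter, not_lt] at hi
    have h2 : 2 * q i ≤ p i := by
      by_cases h0 : x i = 0
      · have : q i = 0 := by simp [hq, h0]
        rw [this, mul_zero]
        exact hp0 i
      · exact (hcon i hi.1 h0 hi.2).le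
    nlinarith [ha i hi.1]
  have hdm : 15 / 16 * ∑ i ∈ d, a i ≤ ∑ i ∈ d, a i * p i := by
    rw [Finset.mul_sum]
    refine Finset.sum_le_sum fun i hi => ?_
    have := (Finset.mem_filter.1 hi).2
    nlinarith [ha i (hds hi)]
  have hrest : 0 ≤ ∑ i ∈ s with ¬ 15 / 16 < p i, a i * p i :=
    Finset.sum_nonneg fun i hi => mul_nonneg (ha i (Finset.mem_filter.1 hi).1) (hp0 i)
  have hdn : 0 ≤ ∑ i ∈ d, a i := Finset.sum_nonneg fun i hi => ha i (hds hi)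
  have hdn' : 0 ≤ ∑ i ∈ d, a i * p i :=
    Finset.sum_nonneg fun i hi => mul_nonneg (ha i (hds hi)) (hp0 i)
  have e1 := hsplit fun i => a i * q i
  have e2 := hsplit fun i => a i * p i
  set D := ∑ i ∈ d, a i
  set S := ∑ i ∈ d, a i * q i
  set X := ∑ i ∈ s, a i * q i
  set P := ∑ i ∈ s, a i * p i
  have hX0 : 0 < X := hpos.trans_le hle
  have hS : X / 2 ≤ S := by linarith
  have hDR : D * R ^ 2 ≤ 1 / 9 := by
    have := mul_le_mul_of_nonneg_right hdense (sq_nonneg R)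
    calc D * R ^ 2 ≤ _ := this
      _ = 1 / 9 := by field_simp
  -- the bound `1 / (9 * R ^ 2)` on `D` makes the constant `16 / 135` here smaller than `1 / 4`
  have hDP : D ≤ 16 / 15 * X := by linarith
  have h3 : D ^ 2 * R ^ 2 ≤ 16 / 135 * X := by
    calc D ^ 2 * R ^ 2 = D * (D * R ^ 2) := by ring
      _ ≤ (16 / 15 * X) * (1 / 9) := by
        apply mul_le_mul hDP hDR (by positivity) (by positivity)
      _ = _ := by ring
  have h4 : S ^ 2 ≤ 16 / 135 * X * X :=
    hcs.trans (mul_le_mul_of_nonneg_right (hbb.trans h3) hX0.le)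
  nlinarith

/-! ### Exponential mass of a family of vectors -/

/-- The mass of a finite family of vectors, in which a vector `x` counts `exp (-c ‖x‖ ^ 2)`. -/
noncomputable def expMass {α E : Type*} [NormedAddCommGroup E] (c : ℝ) (s : Finset α)
    (u : α → E) : ℝ :=
  ∑ i ∈ s, Real.exp (-(c * ‖u i‖ ^ 2))

theorem expMass_nonneg {α E : Type*} [NormedAddCommGroup E] (c : ℝ) (s : Finset α) (u : α → E) :
    0 ≤ expMass c s u :=
  Finset.sum_nonneg fun _ _ => (Real.exp_pos _).le

theorem expMass_le_card {α E : Type*} [NormedAddCommGroup E] {c : ℝ} (hc : 0 ≤ c) (s : Finset α)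
    (u : α → E) : expMass c s u ≤ s.card := by
  rw [expMass, Finset.card_eq_sum_ones, Nat.cast_sum]
  refine Finset.sum_le_sum fun i _ => ?_
  rw [Nat.cast_one, Real.exp_le_one_iff, neg_nonpos]
  positivity

/-- Vectors of squared norm above `R` carry little mass. -/
theorem expMass_sub_le_expMass_filter {α E : Type*} [NormedAddCommGroup E] {c : ℝ} (hc : 0 ≤ c)
    (s : Finset α) (u : α → E) (R : ℝ) :
    expMass c s u - s.card * Real.exp (-(c * R)) ≤ expMass c (s.filter fun i => ‖u i‖ ^ 2 ≤ R) u := by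
  classical
  have h := Finset.sum_filter_add_sum_filter_not s (fun i => ‖u i‖ ^ 2 ≤ R)
    fun i => Real.exp (-(c * ‖u i‖ ^ 2))
  have h2 : ∑ i ∈ s with ¬ ‖u i‖ ^ 2 ≤ R, Real.exp (-(c * ‖u i‖ ^ 2)) ≤
      s.card * Real.exp (-(c * R)) := by
    calc _ ≤ ∑ i ∈ s with ¬ ‖u i‖ ^ 2 ≤ R, Real.exp (-(c * R)) := by
          refine Finset.sum_le_sum fun i hi => ?_
          have := (Finset.mem_filter.1 hi).2
          rw [not_le] at this
          gcongr
      _ = (s.filter fun i => ¬ ‖u i‖ ^ 2 ≤ R).card * Real.exp (-(c * R)) := by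
          rw [Finset.sum_const, nsmul_eq_mul]
      _ ≤ _ := by
          gcongr
          exact Finset.filter_subset _ _
  unfold expMass
  linarith

/-- Projecting the row vectors onto the orthogonal complement of `u i₀`, and keeping only the
columns orthogonal to `u i₀`, does not decrease the product of the masses: the row mass grows by
the factor `1 + 32 q` and the column mass shrinks by the factor `1 - p`. -/
theorem exists_expMass_mul_le_of_project {α β E : Type*} [NormedAddCommGroup E]
    [InnerProductSpace ℝ E] (A : Finset α) (B : Finset β) (u : α → E) (v : β → E) {R : ℝ}
    (hv : 0 < expMass (32 * R) B v)
    (huR : ∀ i ∈ A, ‖u i‖ ^ 2 ≤ R)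
    (h01 : ∀ i ∈ A, ∀ j ∈ B, inner ℝ (u i) (v j) = 0 ∨ inner ℝ (u i) (v j) = 1)
    {i₀ : α} (hi₀ : i₀ ∈ A) (hu₀ : u i₀ ≠ 0) {p q : ℝ}
    (hp : p * expMass (32 * R) B v =
      ∑ j ∈ B, Real.exp (-(32 * R * ‖v j‖ ^ 2)) * inner ℝ (u i₀) (v j) ^ 2)
    (hq : q * expMass (32 * R) A u =
      ∑ i ∈ A, Real.exp (-(32 * R * ‖u i‖ ^ 2)) * inner ℝ (u i₀) (u i) ^ 2)
    (hp1 : p ≤ 15 / 16) (hpq : p ≤ 2 * q) :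
    ∃ (u' : α → E) (B' : Finset β), B' ⊆ B ∧ (∀ i, ‖u' i‖ ^ 2 ≤ ‖u i‖ ^ 2) ∧
      (∀ i, ∀ j ∈ B', inner ℝ (u' i) (v j) = inner ℝ (u i) (v j)) ∧ u' i₀ = 0 ∧
      (∀ i, u i = 0 → u' i = 0) ∧
      expMass (32 * R) A u * expMass (32 * R) B v ≤
        expMass (32 * R) A u' * expMass (32 * R) B' v := by
  classical
  have hn : 0 < ‖u i₀‖ ^ 2 := by positivity
  have hnorm : ∀ i, ‖u i - (inner ℝ (u i₀) (u i) / ‖u i₀‖ ^ 2) • u i₀‖ ^ 2 =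
      ‖u i‖ ^ 2 - inner ℝ (u i₀) (u i) ^ 2 / ‖u i₀‖ ^ 2 := by
    intro i
    rw [norm_sub_sq_real, real_inner_smul_right, real_inner_comm, norm_smul, mul_pow,
      Real.norm_eq_abs, sq_abs]
    field_simp
    ring
  refine ⟨fun i => u i - (inner ℝ (u i₀) (u i) / ‖u i₀‖ ^ 2) • u i₀,
    B.filter fun j => inner ℝ (u i₀) (v j) = 0, Finset.filter_subset _ _, fun i => ?_,
    fun i j hj => ?_, ?_, fun i hi => ?_, ?_⟩
  · simp only [hnorm]
    have : 0 ≤ inner ℝ (u i₀) (u i) ^ 2 / ‖u i₀‖ ^ 2 := by positivity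
    linarith
  · rw [inner_sub_left, real_inner_smul_left, (Finset.mem_filter.1 hj).2]
    simp
  · simp only [real_inner_self_eq_norm_sq]
    rw [div_self hn.ne', one_smul, sub_self]
  · simp [hi]
  · have hB : expMass (32 * R) (B.filter fun j => inner ℝ (u i₀) (v j) = 0) v =
        (1 - p) * expMass (32 * R) B v := by
      rw [sub_mul, hp, one_mul, expMass, expMass, Finset.sum_filter, ← Finset.sum_sub_distrib]
      refine Finset.sum_congr rfl fun j hj => ?_
      rcases h01 i₀ hi₀ j hj with h | h <;> simp [h]
    have hA : (1 + 32 * q) * expMass (32 * R) A u ≤ expMass (32 * R) A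
        fun i => u i - (inner ℝ (u i₀) (u i) / ‖u i₀‖ ^ 2) • u i₀ := by
      rw [add_mul, one_mul, mul_assoc, hq, Finset.mul_sum, expMass, expMass,
        ← Finset.sum_add_distrib]
      refine Finset.sum_le_sum fun i _ => ?_
      rw [hnorm]
      set e := inner ℝ (u i₀) (u i) ^ 2
      have he : 0 ≤ e := sq_nonneg _
      have h1 : 32 * e ≤ 32 * R * (e / ‖u i₀‖ ^ 2) := by
        rw [mul_assoc, mul_div_assoc']
        gcongr
        rw [le_div_iff₀ hn, mul_comm]
        gcongr
        exact huR i₀ hi₀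
      have h2 := Real.add_one_le_exp (32 * R * (e / ‖u i₀‖ ^ 2))
      have h3 : Real.exp (-(32 * R * (‖u i‖ ^ 2 - e / ‖u i₀‖ ^ 2))) =
          Real.exp (-(32 * R * ‖u i‖ ^ 2)) * Real.exp (32 * R * (e / ‖u i₀‖ ^ 2)) := by
        rw [← Real.exp_add]
        ring_nf
      rw [h3]
      nlinarith [Real.exp_pos (-(32 * R * ‖u i‖ ^ 2))]
    have hp0 : 0 ≤ p := by
      have : 0 ≤ p * expMass (32 * R) B v := by
        rw [hp]
        exact Finset.sum_nonneg fun j _ => mul_nonneg (Real.exp_pos _).le (sq_nonneg _)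
      exact nonneg_of_mul_nonneg_left this hv
    have hA0 := expMass_nonneg (32 * R) A u
    rw [hB]
    calc expMass (32 * R) A u * expMass (32 * R) B v
        ≤ ((1 + 32 * q) * (1 - p)) * (expMass (32 * R) A u * expMass (32 * R) B v) := by
          refine le_mul_of_one_le_left (mul_nonneg hA0 hv.le) ?_
          nlinarith
      _ = ((1 + 32 * q) * expMass (32 * R) A u) * ((1 - p) * expMass (32 * R) B v) := by ring
      _ ≤ _ := mul_le_mul_of_nonneg_right hA (mul_nonneg (by linarith) hv.le)

/-! ### Complementing a dense matrix -/

/-- Recentring at the weighted mean `a`, at the price of the extra squared norm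
`1 / 4 + 4 (ε - η / 2) ^ 2`, gains mass when all inner products with `b` are at most `1` and
nearly `1` on average. Here `ε = 1 - ⟪u i, b⟫` has mean `η = 1 - ⟪a, b⟫`. -/
theorem exp_mul_expMass_le_of_recentre {α E F : Type*} [NormedAddCommGroup E]
    [InnerProductSpace ℝ E] [NormedAddCommGroup F] {c : ℝ} (hc : 0 ≤ c) (s : Finset α)
    (u : α → E) (u' : α → F) (a b : E) (hs : 0 < expMass c s u)
    (ha : expMass c s u • a = ∑ i ∈ s, Real.exp (-(c * ‖u i‖ ^ 2)) • u i)
    (h0 : ∀ i ∈ s, 0 ≤ inner ℝ (u i) b) (h1 : ∀ i ∈ s, inner ℝ (u i) b ≤ 1)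
    (hab : 15 / 16 ≤ inner ℝ a b)
    (hu' : ∀ i, ‖u' i‖ ^ 2 = ‖u i - a‖ ^ 2 + 1 / 4 +
      4 * ((1 - inner ℝ (u i) b) - (1 - inner ℝ a b) / 2) ^ 2) :
    Real.exp (c * (‖a‖ ^ 2 - 1 / 2)) * expMass c s u ≤ expMass c s u' := by
  set w : α → ℝ := fun i => Real.exp (-(c * ‖u i‖ ^ 2)) with hw
  have hw0 : ∀ i, 0 < w i := fun i => Real.exp_pos _
  have hW : expMass c s u = ∑ i ∈ s, w i := rfl
  have hmean : ∀ z : E, ∑ i ∈ s, w i * inner ℝ (u i) z = expMass c s u * inner ℝ a z := by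
    intro z
    rw [← real_inner_smul_left, ha, sum_inner]
    exact Finset.sum_congr rfl fun i _ => (real_inner_smul_left _ _ _).symm
  have key : (c * (‖a‖ ^ 2 - 1 / 2)) * ∑ i ∈ s, w i ≤
      ∑ i ∈ s, w i * (c * (‖u i‖ ^ 2 - ‖u' i‖ ^ 2)) := by
    set g := inner ℝ a b
    -- `(ε - η / 2) ^ 2 ≤ ε (1 - η) + η ^ 2 / 4` because `ε ^ 2 ≤ ε`
    have hterm : ∀ i ∈ s, w i * (c * (2 * inner ℝ (u i) a - ‖a‖ ^ 2 - 1 / 4 -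
        4 * ((1 - inner ℝ (u i) b) * g + (1 - g) ^ 2 / 4))) ≤
        w i * (c * (‖u i‖ ^ 2 - ‖u' i‖ ^ 2)) := by
      intro i hi
      refine mul_le_mul_of_nonneg_left (mul_le_mul_of_nonneg_left ?_ hc) (hw0 i).le
      rw [hu', norm_sub_sq_real]
      have e0 := h0 i hi
      have e1 := h1 i hi
      nlinarith [mul_nonneg e0 (sub_nonneg.2 e1)]
    refine le_trans ?_ (Finset.sum_le_sum hterm)
    have hg1 : g ≤ 1 := by
      have h2 := hmean b
      have h3 : ∑ i ∈ s, w i * inner ℝ (u i) b ≤ ∑ i ∈ s, w i :=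
        Finset.sum_le_sum fun i hi => mul_le_of_le_one_right (hw0 i).le (h1 i hi)
      rw [h2, ← hW] at h3
      nlinarith
    have hsum : ∑ i ∈ s, w i * (c * (2 * inner ℝ (u i) a - ‖a‖ ^ 2 - 1 / 4 -
        4 * ((1 - inner ℝ (u i) b) * g + (1 - g) ^ 2 / 4))) =
        c * (2 * ∑ i ∈ s, w i * inner ℝ (u i) a + 4 * g * ∑ i ∈ s, w i * inner ℝ (u i) b -
          (‖a‖ ^ 2 + 1 / 4 + 4 * g + (1 - g) ^ 2) * ∑ i ∈ s, w i) := by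
      simp only [Finset.mul_sum, ← Finset.sum_add_distrib, ← Finset.sum_sub_distrib]
      exact Finset.sum_congr rfl fun i _ => by ring
    rw [hsum, hmean, hmean, real_inner_self_eq_norm_sq, ← hW, mul_assoc]
    refine mul_le_mul_of_nonneg_left ?_ hc
    have : 0 ≤ expMass c s u * (1 / 4 - 4 * g + 4 * g ^ 2 - (1 - g) ^ 2) := by
      refine mul_nonneg hs.le ?_
      nlinarith
    nlinarith
  calc Real.exp (c * (‖a‖ ^ 2 - 1 / 2)) * expMass c s u
      ≤ ∑ i ∈ s, w i * Real.exp (c * (‖u i‖ ^ 2 - ‖u' i‖ ^ 2)) :=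
        exp_mul_sum_le_sum_mul_exp s w _ _ (fun i _ => (hw0 i).le) key
    _ = expMass c s u' := by
        refine Finset.sum_congr rfl fun i _ => ?_
        rw [hw, ← Real.exp_add]
        ring_nf

/-- If the matrix of inner products is Boolean with weighted density at least `15 / 16`, then its
complement is a matrix of inner products of two families of vectors of much larger mass. -/
theorem exists_inner_eq_one_sub {α β E : Type*} [NormedAddCommGroup E]
    [InnerProductSpace ℝ E] {c : ℝ} (hc : 0 ≤ c) (A : Finset α) (B : Finset β) (u : α → E)
    (v : β → E) (hu : 0 < expMass c A u) (hv : 0 < expMass c B v)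
    (h01 : ∀ i ∈ A, ∀ j ∈ B, inner ℝ (u i) (v j) = 0 ∨ inner ℝ (u i) (v j) = 1)
    (hdense : 15 / 16 * (expMass c A u * expMass c B v) ≤ ∑ i ∈ A, ∑ j ∈ B,
      Real.exp (-(c * ‖u i‖ ^ 2)) * Real.exp (-(c * ‖v j‖ ^ 2)) * inner ℝ (u i) (v j)) :
    ∃ (u' : α → WithLp 2 (E × EuclideanSpace ℝ (Fin 2)))
      (v' : β → WithLp 2 (E × EuclideanSpace ℝ (Fin 2))) (r₁ r₂ : ℝ),
      (∀ i j, inner ℝ (u' i) (v' j) = 1 - inner ℝ (u i) (v j)) ∧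
      -1 / 2 ≤ r₁ ∧ -1 / 2 ≤ r₂ ∧ 7 / 8 ≤ r₁ + r₂ ∧
      Real.exp (c * r₁) * expMass c A u ≤ expMass c A u' ∧
      Real.exp (c * r₂) * expMass c B v ≤ expMass c B v' := by
  set a : E := (expMass c A u)⁻¹ • ∑ i ∈ A, Real.exp (-(c * ‖u i‖ ^ 2)) • u i with ha
  set b : E := (expMass c B v)⁻¹ • ∑ j ∈ B, Real.exp (-(c * ‖v j‖ ^ 2)) • v j with hb
  have ha' : expMass c A u • a = ∑ i ∈ A, Real.exp (-(c * ‖u i‖ ^ 2)) • u i := by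
    rw [ha, smul_inv_smul₀ hu.ne']
  have hb' : expMass c B v • b = ∑ j ∈ B, Real.exp (-(c * ‖v j‖ ^ 2)) • v j := by
    rw [hb, smul_inv_smul₀ hv.ne']
  have hab : 15 / 16 ≤ inner ℝ a b := by
    have h : expMass c A u * expMass c B v * inner ℝ a b = ∑ i ∈ A, ∑ j ∈ B,
        Real.exp (-(c * ‖u i‖ ^ 2)) * Real.exp (-(c * ‖v j‖ ^ 2)) * inner ℝ (u i) (v j) := by
      rw [mul_assoc, ← real_inner_smul_right, ← real_inner_smul_left, ha', hb', sum_inner]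
      refine Finset.sum_congr rfl fun i _ => ?_
      rw [inner_sum]
      refine Finset.sum_congr rfl fun j _ => ?_
      rw [real_inner_smul_left, real_inner_smul_right]
      ring
    rw [← h, mul_comm] at hdense
    exact le_of_mul_le_mul_left hdense (mul_pos hu hv)
  have hub : ∀ i ∈ A, 0 ≤ inner ℝ (u i) b ∧ inner ℝ (u i) b ≤ 1 := by
    intro i hi
    have h : expMass c B v * inner ℝ (u i) b =
        ∑ j ∈ B, Real.exp (-(c * ‖v j‖ ^ 2)) * inner ℝ (u i) (v j) := by
      rw [← real_inner_smul_right, hb', inner_sum]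
      exact Finset.sum_congr rfl fun j _ => real_inner_smul_right _ _ _
    constructor
    · refine nonneg_of_mul_nonneg_right (a := expMass c B v) ?_ hv
      rw [h]
      refine Finset.sum_nonneg fun j hj => mul_nonneg (Real.exp_pos _).le ?_
      rcases h01 i hi j hj with h | h <;> simp [h]
    · refine le_of_mul_le_mul_left ?_ hv
      rw [h, mul_one]
      refine Finset.sum_le_sum fun j hj => mul_le_of_le_one_right (Real.exp_pos _).le ?_
      rcases h01 i hi j hj with h | h <;> simp [h]
  have hva : ∀ j ∈ B, 0 ≤ inner ℝ (v j) a ∧ inner ℝ (v j) a ≤ 1 := by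
    intro j hj
    have h : expMass c A u * inner ℝ (v j) a =
        ∑ i ∈ A, Real.exp (-(c * ‖u i‖ ^ 2)) * inner ℝ (u i) (v j) := by
      rw [← real_inner_smul_right, ha', inner_sum]
      exact Finset.sum_congr rfl fun j _ => by rw [real_inner_smul_right, real_inner_comm]
    constructor
    · refine nonneg_of_mul_nonneg_right (a := expMass c A u) ?_ hu
      rw [h]
      refine Finset.sum_nonneg fun i hi => mul_nonneg (Real.exp_pos _).le ?_
      rcases h01 i hi j hj with h | h <;> simp [h]
    · refine le_of_mul_le_mul_left ?_ hu
      rw [h, mul_one]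
      refine Finset.sum_le_sum fun i hi => mul_le_of_le_one_right (Real.exp_pos _).le ?_
      rcases h01 i hi j hj with h | h <;> simp [h]
  set η : ℝ := 1 - inner ℝ a b with hη
  refine ⟨fun i => WithLp.toLp 2 (a - u i, !₂[1 / 2, 2 * ((1 - inner ℝ (u i) b) - η / 2)]),
    fun j => WithLp.toLp 2 (v j - b, !₂[2 * ((1 - inner ℝ (v j) a) - η / 2), 1 / 2]),
    ‖a‖ ^ 2 - 1 / 2, ‖b‖ ^ 2 - 1 / 2, fun i j => ?_, ?_, ?_, ?_, ?_, ?_⟩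
  · rw [WithLp.prod_inner_apply]
    simp only [inner_sub_left, inner_sub_right, PiLp.inner_apply, Fin.sum_univ_two,
      hη, real_inner_comm a (v j)]
    simp
    ring
  · nlinarith [sq_nonneg ‖a‖]
  · nlinarith [sq_nonneg ‖b‖]
  · have := real_inner_le_norm a b
    nlinarith [sq_nonneg (‖a‖ - ‖b‖)]
  · refine exp_mul_expMass_le_of_recentre hc A u _ a b hu ha' (fun i hi => (hub i hi).1)
      (fun i hi => (hub i hi).2) hab fun i => ?_
    rw [WithLp.prod_norm_sq_eq_of_L2, EuclideanSpace.norm_sq_eq, norm_sub_rev (u i) a]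
    simp only [Fin.sum_univ_two, Real.norm_eq_abs, sq_abs, hη]
    simp
    ring
  · refine exp_mul_expMass_le_of_recentre hc B v _ b a hv hb' (fun j hj => (hva j hj).1)
      (fun j hj => (hva j hj).2) (by rwa [real_inner_comm]) fun j => ?_
    rw [WithLp.prod_norm_sq_eq_of_L2, EuclideanSpace.norm_sq_eq]
    simp only [Fin.sum_univ_two, Real.norm_eq_abs, sq_abs, real_inner_comm a b]
    simp
    ring

/-! ### Monochromatic submatrices of a Boolean Gram matrix -/

/-- Complementing a dense Boolean matrix of inner products, and then discarding the vectors of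
squared norm above `R`, multiplies the product of the masses by at least `18 R ^ 2`. -/
theorem exists_complement {α β E : Type*} [Fintype α] [Fintype β] [NormedAddCommGroup E]
    [InnerProductSpace ℝ E] {R : ℝ} (hR : 2 ≤ R) (A : Finset α) (B : Finset β) (u : α → E)
    (v : β → E)
    (h01 : ∀ i ∈ A, ∀ j ∈ B, inner ℝ (u i) (v j) = 0 ∨ inner ℝ (u i) (v j) = 1)
    (hcard : 0 < (Fintype.card α : ℝ) * Fintype.card β)
    (hmass : 1 / (9 * R ^ 2) * (Fintype.card α * Fintype.card β * Real.exp (-(16 * R ^ 2))) ≤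
      expMass (32 * R) A u * expMass (32 * R) B v)
    (hdense : 15 / 16 * (expMass (32 * R) A u * expMass (32 * R) B v) ≤ ∑ i ∈ A, ∑ j ∈ B,
      Real.exp (-(32 * R * ‖u i‖ ^ 2)) * Real.exp (-(32 * R * ‖v j‖ ^ 2)) *
        inner ℝ (u i) (v j)) :
    ∃ (u' : α → WithLp 2 (E × EuclideanSpace ℝ (Fin 2)))
      (v' : β → WithLp 2 (E × EuclideanSpace ℝ (Fin 2))) (A' : Finset α) (B' : Finset β),
      A' ⊆ A ∧ B' ⊆ B ∧ (∀ i ∈ A', ‖u' i‖ ^ 2 ≤ R) ∧ (∀ j ∈ B', ‖v' j‖ ^ 2 ≤ R) ∧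
      (∀ i j, inner ℝ (u' i) (v' j) = 1 - inner ℝ (u i) (v j)) ∧
      18 * R ^ 2 * (expMass (32 * R) A u * expMass (32 * R) B v) ≤
        expMass (32 * R) A' u' * expMass (32 * R) B' v' := by
  classical
  have hc : 0 ≤ 32 * R := by linarith
  have hpos : 0 < expMass (32 * R) A u * expMass (32 * R) B v :=
    lt_of_lt_of_le (by positivity) hmass
  have hu : 0 < expMass (32 * R) A u := pos_of_mul_pos_left hpos (expMass_nonneg _ _ _)
  have hv : 0 < expMass (32 * R) B v := pos_of_mul_pos_right hpos (expMass_nonneg _ _ _)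
  obtain ⟨u', v', r₁, r₂, hinner, hr₁, hr₂, hr, hu', hv'⟩ :=
    exists_inner_eq_one_sub hc A B u v hu hv h01 hdense
  have hmα : (0 : ℝ) < Fintype.card α := pos_of_mul_pos_left hcard (Nat.cast_nonneg _)
  have hmβ : (0 : ℝ) < Fintype.card β := pos_of_mul_pos_right hcard (Nat.cast_nonneg _)
  have hAc : expMass (32 * R) A u ≤ Fintype.card α :=
    (expMass_le_card hc A u).trans (by exact_mod_cast A.card_le_univ)
  have hBc : expMass (32 * R) B v ≤ Fintype.card β :=
    (expMass_le_card hc B v).trans (by exact_mod_cast B.card_le_univ)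
  have hAl : 1 / (9 * R ^ 2) * (Fintype.card α * Real.exp (-(16 * R ^ 2))) ≤
      expMass (32 * R) A u := by
    refine le_of_mul_le_mul_right ?_ hmβ
    calc _ = 1 / (9 * R ^ 2) * (Fintype.card α * Fintype.card β * Real.exp (-(16 * R ^ 2))) := by
          ring
      _ ≤ _ := hmass.trans (mul_le_mul_of_nonneg_left hBc hu.le)
  have hBl : 1 / (9 * R ^ 2) * (Fintype.card β * Real.exp (-(16 * R ^ 2))) ≤
      expMass (32 * R) B v := by
    refine le_of_mul_le_mul_left ?_ hmα
    calc _ = 1 / (9 * R ^ 2) * (Fintype.card α * Fintype.card β * Real.exp (-(16 * R ^ 2))) := by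
          ring
      _ ≤ _ := hmass.trans (mul_le_mul_of_nonneg_right hAc hv.le)
  have hexp : 18 * R ^ 2 * Real.exp (-(32 * R * R)) ≤
      Real.exp (-(16 * R ^ 2)) * Real.exp (32 * R * (-1 / 2)) := by
    have h2 := Real.quadratic_le_exp_of_nonneg (x := 16 * R) (by linarith)
    have h3 : Real.exp (16 * R) * Real.exp (-(32 * R * R)) ≤
        Real.exp (-(16 * R ^ 2)) * Real.exp (32 * R * (-1 / 2)) := by
      rw [← Real.exp_add, ← Real.exp_add, Real.exp_le_exp]
      nlinarith
    refine le_trans ?_ h3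
    refine mul_le_mul_of_nonneg_right ?_ (Real.exp_pos _).le
    nlinarith
  -- discarding the long vectors costs at most half of the mass
  have hdisc : ∀ k W W' r : ℝ, 0 ≤ k → 0 ≤ W →
      1 / (9 * R ^ 2) * (k * Real.exp (-(16 * R ^ 2))) ≤ W → -1 / 2 ≤ r →
      Real.exp (32 * R * r) * W ≤ W' →
      Real.exp (32 * R * r) * W / 2 ≤ W' - k * Real.exp (-(32 * R * R)) := by
    intro k W W' r hk hW0 hW hr hW'
    have h1 : 2 * (k * Real.exp (-(32 * R * R))) ≤ Real.exp (32 * R * r) * W := by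
      calc 2 * (k * Real.exp (-(32 * R * R)))
          = 1 / (9 * R ^ 2) * k * (18 * R ^ 2 * Real.exp (-(32 * R * R))) := by field_simp; ring
        _ ≤ 1 / (9 * R ^ 2) * k * (Real.exp (-(16 * R ^ 2)) * Real.exp (32 * R * (-1 / 2))) :=
            mul_le_mul_of_nonneg_left hexp (by positivity)
        _ = Real.exp (32 * R * (-1 / 2)) * (1 / (9 * R ^ 2) * (k * Real.exp (-(16 * R ^ 2)))) := by
            ring
        _ ≤ Real.exp (32 * R * r) * W := by gcongr
    linarith
  have hA' := expMass_sub_le_expMass_filter hc A u' R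
  have hB' := expMass_sub_le_expMass_filter hc B v' R
  have hAk : (A.card : ℝ) * Real.exp (-(32 * R * R)) ≤
      Fintype.card α * Real.exp (-(32 * R * R)) := by
    gcongr
    exact A.card_le_univ
  have hBk : (B.card : ℝ) * Real.exp (-(32 * R * R)) ≤
      Fintype.card β * Real.exp (-(32 * R * R)) := by
    gcongr
    exact B.card_le_univ
  have hA2 := hdisc _ _ _ r₁ hmα.le hu.le hAl hr₁ hu'
  have hB2 := hdisc _ _ _ r₂ hmβ.le hv.le hBl hr₂ hv'
  refine ⟨u', v', A.filter fun i => ‖u' i‖ ^ 2 ≤ R, B.filter fun j => ‖v' j‖ ^ 2 ≤ R,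
    Finset.filter_subset _ _, Finset.filter_subset _ _, fun i hi => (Finset.mem_filter.1 hi).2,
    fun j hj => (Finset.mem_filter.1 hj).2, hinner, ?_⟩
  have hgain : 72 * R ^ 2 ≤ Real.exp (32 * R * r₁) * Real.exp (32 * R * r₂) := by
    rw [← Real.exp_add]
    have h2 := Real.quadratic_le_exp_of_nonneg (x := 28 * R) (by linarith)
    have h3 : Real.exp (28 * R) ≤ Real.exp (32 * R * r₁ + 32 * R * r₂) := by
      rw [Real.exp_le_exp]
      nlinarith
    nlinarith
  calc 18 * R ^ 2 * (expMass (32 * R) A u * expMass (32 * R) B v)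
      = 72 * R ^ 2 * (expMass (32 * R) A u * expMass (32 * R) B v) / 4 := by ring
    _ ≤ Real.exp (32 * R * r₁) * Real.exp (32 * R * r₂) *
          (expMass (32 * R) A u * expMass (32 * R) B v) / 4 := by gcongr
    _ = (Real.exp (32 * R * r₁) * expMass (32 * R) A u / 2) *
          (Real.exp (32 * R * r₂) * expMass (32 * R) B v / 2) := by ring
    _ ≤ _ := mul_le_mul (by linarith) (by linarith) (by positivity) (expMass_nonneg _ _ _)

/-- One step for the rows: either a row vector can be projected away without decreasing the product
of the masses, or the dense rows carry a non-negligible part of the mass. -/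
theorem exists_project_or_exists_dense {α β E : Type*} [NormedAddCommGroup E]
    [InnerProductSpace ℝ E] {R : ℝ} (hR : 0 < R) (A : Finset α) (B : Finset β) (u : α → E)
    (v : β → E) (hu : 0 < expMass (32 * R) A u) (hv : 0 < expMass (32 * R) B v)
    (huR : ∀ i ∈ A, ‖u i‖ ^ 2 ≤ R)
    (h01 : ∀ i ∈ A, ∀ j ∈ B, inner ℝ (u i) (v j) = 0 ∨ inner ℝ (u i) (v j) = 1)
    {a : α → ℝ} (ha : ∀ i, a i = Real.exp (-(32 * R * ‖u i‖ ^ 2)) / expMass (32 * R) A u)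
    {b : β → ℝ} (hb : ∀ j, b j = Real.exp (-(32 * R * ‖v j‖ ^ 2)) / expMass (32 * R) B v)
    (hpos : 0 < ∑ i ∈ A, ∑ j ∈ B, a i * b j * inner ℝ (u i) (v j) ^ 2)
    (hle : ∑ i ∈ A, ∑ j ∈ B, a i * b j * inner ℝ (u i) (v j) ^ 2 ≤
      ∑ i ∈ A, ∑ i' ∈ A, a i * a i' * inner ℝ (u i) (u i') ^ 2) :
    (∃ (u' : α → E) (B' : Finset β) (i₀ : α), i₀ ∈ A ∧ u i₀ ≠ 0 ∧ B' ⊆ B ∧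
      (∀ i, ‖u' i‖ ^ 2 ≤ ‖u i‖ ^ 2) ∧
      (∀ i, ∀ j ∈ B', inner ℝ (u' i) (v j) = inner ℝ (u i) (v j)) ∧ u' i₀ = 0 ∧
      (∀ i, u i = 0 → u' i = 0) ∧
      expMass (32 * R) A u * expMass (32 * R) B v ≤
        expMass (32 * R) A u' * expMass (32 * R) B' v) ∨
    ∃ A' ⊆ A, 1 / (9 * R ^ 2) * expMass (32 * R) A u ≤ expMass (32 * R) A' u ∧
      15 / 16 * (expMass (32 * R) A' u * expMass (32 * R) B v) ≤ ∑ i ∈ A', ∑ j ∈ B,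
        Real.exp (-(32 * R * ‖u i‖ ^ 2)) * Real.exp (-(32 * R * ‖v j‖ ^ 2)) *
          inner ℝ (u i) (v j) := by
  classical
  have ha0 : ∀ i ∈ A, 0 ≤ a i := fun i _ => by
    rw [ha]
    positivity
  have hb0 : ∀ j ∈ B, 0 ≤ b j := fun j _ => by
    rw [hb]
    positivity
  by_cases hdense : ∑ i ∈ A with 15 / 16 < ∑ j ∈ B, b j * inner ℝ (u i) (v j) ^ 2, a i ≤
      1 / (9 * R ^ 2)
  · left
    obtain ⟨i₀, hi₀, hu₀, hp, hpq⟩ := exists_inner_col_le_two_mul_inner_row A B a b u v hR ha0 hb0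
      huR hdense hpos hle
    obtain ⟨u', B', hB', hn, hinner, hz, hzz, hm⟩ := exists_expMass_mul_le_of_project A B u v hv huR
      h01 hi₀ hu₀ (p := ∑ j ∈ B, b j * inner ℝ (u i₀) (v j) ^ 2)
      (q := ∑ i' ∈ A, a i' * inner ℝ (u i₀) (u i') ^ 2)
      (by
        rw [Finset.sum_mul]
        refine Finset.sum_congr rfl fun j _ => ?_
        rw [hb]
        field_simp)
      (by
        rw [Finset.sum_mul]
        refine Finset.sum_congr rfl fun j _ => ?_
        rw [ha]
        field_simp) hp hpq
    exact ⟨u', B', i₀, hi₀, hu₀, hB', hn, hinner, hz, hzz, hm⟩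
  · right
    rw [not_le] at hdense
    refine ⟨_, Finset.filter_subset (fun i => 15 / 16 < ∑ j ∈ B, b j * inner ℝ (u i) (v j) ^ 2) A,
      ?_, ?_⟩
    · simp only [ha] at hdense
      rw [← Finset.sum_div, lt_div_iff₀ hu] at hdense
      exact hdense.le
    · rw [expMass, Finset.sum_mul, Finset.mul_sum]
      refine Finset.sum_le_sum fun i hi => ?_
      rw [Finset.mem_filter] at hi
      have h1 : ∑ j ∈ B, Real.exp (-(32 * R * ‖u i‖ ^ 2)) * Real.exp (-(32 * R * ‖v j‖ ^ 2)) *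
          inner ℝ (u i) (v j) = Real.exp (-(32 * R * ‖u i‖ ^ 2)) * (expMass (32 * R) B v *
            ∑ j ∈ B, b j * inner ℝ (u i) (v j) ^ 2) := by
        rw [Finset.mul_sum, Finset.mul_sum]
        refine Finset.sum_congr rfl fun j hj => ?_
        have h2 : inner ℝ (u i) (v j) ^ 2 = inner ℝ (u i) (v j) := by
          rcases h01 i hi.1 j hj with h | h <;> simp [h]
        rw [h2, hb]
        field_simp
      rw [h1]
      have h3 := mul_le_mul_of_nonneg_left hi.2.le
        (mul_nonneg (Real.exp_pos (-(32 * R * ‖u i‖ ^ 2))).le hv.le)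
      linarith

theorem card_filter_ne_zero_lt {α E : Type*} [Zero E] [DecidableEq E] {s s' : Finset α}
    {w w' : α → E} {i₀ : α} (hs : s' ⊆ s) (hi₀ : i₀ ∈ s) (hw : w i₀ ≠ 0) (hw' : w' i₀ = 0)
    (hww : ∀ i, w i = 0 → w' i = 0) :
    {i ∈ s' | w' i ≠ 0}.card < {i ∈ s | w i ≠ 0}.card := by
  refine Finset.card_lt_card ((Finset.ssubset_iff_of_subset fun i hi => ?_).2
    ⟨i₀, Finset.mem_filter.2 ⟨hi₀, hw⟩, fun h => (Finset.mem_filter.1 h).2 hw'⟩)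
  rw [Finset.mem_filter] at hi ⊢
  exact ⟨hs hi.1, fun h => hi.2 (hww i h)⟩

open Classical in
/-- A Boolean matrix of inner products of vectors of squared norm at most `R`, whose masses have a
large product, contains a large monochromatic submatrix. The number `N` bounds how often the matrix
can still be complemented, and `k` how many vectors can still be projected away in between. -/
theorem exists_monochromatic_of_expMass {α β : Type*} [Fintype α] [Fintype β] {R : ℝ}
    (hR : 2 ≤ R) (hcard : 0 < (Fintype.card α : ℝ) * Fintype.card β) (N : ℕ) :
    ∀ (k : ℕ) (E : Type) [NormedAddCommGroup E] [InnerProductSpace ℝ E] (M : α → β → ℝ)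
      (A : Finset α) (B : Finset β) (u : α → E) (v : β → E),
      (∀ i ∈ A, ∀ j ∈ B, M i j = 0 ∨ M i j = 1) →
      (∀ i ∈ A, ‖u i‖ ^ 2 ≤ R) → (∀ j ∈ B, ‖v j‖ ^ 2 ≤ R) →
      (∀ i ∈ A, ∀ j ∈ B, inner ℝ (u i) (v j) = M i j) →
      {i ∈ A | u i ≠ 0}.card + {j ∈ B | v j ≠ 0}.card ≤ k →
      Fintype.card α * Fintype.card β * Real.exp (-(16 * R ^ 2)) ≤
        expMass (32 * R) A u * expMass (32 * R) B v →
      (Fintype.card α : ℝ) * Fintype.card β ≤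
        2 ^ N * (expMass (32 * R) A u * expMass (32 * R) B v) →
      ∃ (A' : Finset α) (B' : Finset β),
        ((∀ i ∈ A', ∀ j ∈ B', M i j = 0) ∨ (∀ i ∈ A', ∀ j ∈ B', M i j = 1)) ∧
        Fintype.card α * Fintype.card β * Real.exp (-(16 * R ^ 2)) ≤
          (A'.card : ℝ) * B'.card := by
  classical
  have hc : 0 ≤ 32 * R := by linarith
  induction N using Nat.strong_induction_on with
  | _ N ihN =>
  intro k
  induction k using Nat.strong_induction_on with
  | _ k ihk =>
  intro E _ _ M A B u v hM huR hvR hinner hk hmass hN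
  have h01 : ∀ i ∈ A, ∀ j ∈ B, inner ℝ (u i) (v j) = 0 ∨ inner ℝ (u i) (v j) = 1 :=
    fun i hi j hj => by
      rw [hinner i hi j hj]
      exact hM i hi j hj
  have h01' : ∀ j ∈ B, ∀ i ∈ A, inner ℝ (v j) (u i) = 0 ∨ inner ℝ (v j) (u i) = 1 :=
    fun j hj i hi => by
      rw [real_inner_comm]
      exact h01 i hi j hj
  have hpos : 0 < expMass (32 * R) A u * expMass (32 * R) B v :=
    lt_of_lt_of_le (by positivity) hmass
  have hu : 0 < expMass (32 * R) A u := pos_of_mul_pos_left hpos (expMass_nonneg _ _ _)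
  have hv : 0 < expMass (32 * R) B v := pos_of_mul_pos_right hpos (expMass_nonneg _ _ _)
  -- projecting vectors away
  have hmove : ∀ (u' : α → E) (v' : β → E) (A' : Finset α) (B' : Finset β), A' ⊆ A → B' ⊆ B →
      (∀ i, ‖u' i‖ ^ 2 ≤ ‖u i‖ ^ 2) → (∀ j, ‖v' j‖ ^ 2 ≤ ‖v j‖ ^ 2) →
      (∀ i ∈ A', ∀ j ∈ B', inner ℝ (u' i) (v' j) = inner ℝ (u i) (v j)) →
      {i ∈ A' | u' i ≠ 0}.card + {j ∈ B' | v' j ≠ 0}.card <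
        {i ∈ A | u i ≠ 0}.card + {j ∈ B | v j ≠ 0}.card →
      expMass (32 * R) A u * expMass (32 * R) B v ≤
        expMass (32 * R) A' u' * expMass (32 * R) B' v' →
      ∃ (A' : Finset α) (B' : Finset β),
        ((∀ i ∈ A', ∀ j ∈ B', M i j = 0) ∨ (∀ i ∈ A', ∀ j ∈ B', M i j = 1)) ∧
        Fintype.card α * Fintype.card β * Real.exp (-(16 * R ^ 2)) ≤
          (A'.card : ℝ) * B'.card := by
    intro u' v' A' B' hA hB hu' hv' hin hlt hm
    refine ihk _ (hlt.trans_le hk) E M A' B' u' v'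
      (fun i hi j hj => hM i (hA hi) j (hB hj)) (fun i hi => (hu' i).trans (huR i (hA hi)))
      (fun j hj => (hv' j).trans (hvR j (hB hj)))
      (fun i hi j hj => (hin i hi j hj).trans (hinner i (hA hi) j (hB hj))) le_rfl
      (hmass.trans hm) (hN.trans ?_)
    gcongr
  -- complementing a dense submatrix
  have hflip : ∀ (A₁ : Finset α) (B₁ : Finset β), A₁ ⊆ A → B₁ ⊆ B →
      1 / (9 * R ^ 2) * (expMass (32 * R) A u * expMass (32 * R) B v) ≤
        expMass (32 * R) A₁ u * expMass (32 * R) B₁ v →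
      15 / 16 * (expMass (32 * R) A₁ u * expMass (32 * R) B₁ v) ≤ ∑ i ∈ A₁, ∑ j ∈ B₁,
        Real.exp (-(32 * R * ‖u i‖ ^ 2)) * Real.exp (-(32 * R * ‖v j‖ ^ 2)) *
          inner ℝ (u i) (v j) →
      ∃ (A' : Finset α) (B' : Finset β),
        ((∀ i ∈ A', ∀ j ∈ B', M i j = 0) ∨ (∀ i ∈ A', ∀ j ∈ B', M i j = 1)) ∧
        Fintype.card α * Fintype.card β * Real.exp (-(16 * R ^ 2)) ≤
          (A'.card : ℝ) * B'.card := by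
    intro A₁ B₁ hA hB hm hd
    obtain ⟨u', v', A', B', hA', hB', huR', hvR', hin, hgain⟩ := exists_complement hR A₁ B₁ u v
      (fun i hi j hj => h01 i (hA hi) j (hB hj)) hcard
      ((mul_le_mul_of_nonneg_left hmass (by positivity)).trans hm) hd
    have hgain2 : 2 * (expMass (32 * R) A u * expMass (32 * R) B v) ≤
        expMass (32 * R) A' u' * expMass (32 * R) B' v' := by
      refine le_trans ?_ hgain
      have := mul_le_mul_of_nonneg_left hm (show 0 ≤ 18 * R ^ 2 by positivity)
      refine le_trans (le_of_eq ?_) this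
      field_simp
      norm_num
    rcases N with _ | N
    · have h1 : expMass (32 * R) A' u' * expMass (32 * R) B' v' ≤
          Fintype.card α * Fintype.card β :=
        mul_le_mul ((expMass_le_card hc A' u').trans (by exact_mod_cast A'.card_le_univ))
          ((expMass_le_card hc B' v').trans (by exact_mod_cast B'.card_le_univ))
          (expMass_nonneg _ _ _) (Nat.cast_nonneg _)
      linarith
    · obtain ⟨A'', B'', hmono, hsize⟩ := ihN N N.lt_succ_self _ _ (fun i j => 1 - M i j) A' B' u' v'
        (fun i hi j hj => by
          rcases hM i (hA (hA' hi)) j (hB (hB' hj)) with h | h <;> simp [h])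
        huR' hvR' (fun i hi j hj => by rw [hin, hinner i (hA (hA' hi)) j (hB (hB' hj))]) le_rfl
        (by linarith)
        (hN.trans (by
          rw [pow_succ, mul_assoc]
          gcongr))
      refine ⟨A'', B'', hmono.symm.imp (fun h i hi j hj => ?_) fun h i hi j hj => ?_, hsize⟩
      · linarith [h i hi j hj]
      · linarith [h i hi j hj]
  set a : α → ℝ := fun i => Real.exp (-(32 * R * ‖u i‖ ^ 2)) / expMass (32 * R) A u with ha
  set b : β → ℝ := fun j => Real.exp (-(32 * R * ‖v j‖ ^ 2)) / expMass (32 * R) B v with hb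
  have ha0 : ∀ i, 0 < a i := fun i => by positivity
  have hb0 : ∀ j, 0 < b j := fun j => by positivity
  have hterm : ∀ i ∈ A, ∀ j ∈ B, 0 ≤ a i * b j * inner ℝ (u i) (v j) ^ 2 := fun i _ j _ =>
    mul_nonneg (mul_pos (ha0 i) (hb0 j)).le (sq_nonneg _)
  rcases (Finset.sum_nonneg fun i hi => Finset.sum_nonneg (hterm i hi)).eq_or_lt with h0 | hP
  · refine ⟨A, B, Or.inl fun i hi j hj => ?_, hmass.trans (mul_le_mul (expMass_le_card hc _ _)
      (expMass_le_card hc _ _) hv.le (Nat.cast_nonneg _))⟩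
    have h1 := (Finset.sum_eq_zero_iff_of_nonneg fun i hi => Finset.sum_nonneg (hterm i hi)).1
      h0.symm i hi
    have h2 := (Finset.sum_eq_zero_iff_of_nonneg (hterm i hi)).1 h1 j hj
    rw [← hinner i hi j hj]
    exact pow_eq_zero_iff two_ne_zero |>.1
      ((mul_eq_zero.1 h2).resolve_left (mul_pos (ha0 i) (hb0 j)).ne')
  · have hcs := sq_sum_sq_inner_le A B a b u v
    have hflipsum : ∑ j ∈ B, ∑ i ∈ A, b j * a i * inner ℝ (v j) (u i) ^ 2 =
        ∑ i ∈ A, ∑ j ∈ B, a i * b j * inner ℝ (u i) (v j) ^ 2 := by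
      rw [Finset.sum_comm]
      refine Finset.sum_congr rfl fun i _ => Finset.sum_congr rfl fun j _ => ?_
      rw [mul_comm (b j), real_inner_comm]
    rcases le_or_gt (∑ i ∈ A, ∑ j ∈ B, a i * b j * inner ℝ (u i) (v j) ^ 2)
      (∑ i ∈ A, ∑ i' ∈ A, a i * a i' * inner ℝ (u i) (u i') ^ 2) with hX | hX
    · rcases exists_project_or_exists_dense (by linarith) A B u v hu hv huR h01 (fun _ => rfl)
        (fun _ => rfl) hP hX with
        ⟨u', B', i₀, hi₀, hu₀, hB', hn, hin, hz, hzz, hm⟩ | ⟨A', hA', hm, hd⟩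
      · refine hmove u' v A B' subset_rfl hB' hn (fun _ => le_rfl) (fun i _ j hj => hin i j hj)
          (add_lt_add_of_lt_of_le (card_filter_ne_zero_lt subset_rfl hi₀ hu₀ hz hzz) ?_) hm
        gcongr
      · refine hflip A' B hA' subset_rfl ?_ hd
        rw [← mul_assoc]
        gcongr
    · have hY : ∑ j ∈ B, ∑ i ∈ A, b j * a i * inner ℝ (v j) (u i) ^ 2 ≤
          ∑ j ∈ B, ∑ j' ∈ B, b j * b j' * inner ℝ (v j) (v j') ^ 2 := by
        rw [hflipsum]
        by_contra! hY
        have hX0 : 0 ≤ ∑ i ∈ A, ∑ i' ∈ A, a i * a i' * inner ℝ (u i) (u i') ^ 2 :=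
          Finset.sum_nonneg fun i _ => Finset.sum_nonneg fun i' _ =>
            mul_nonneg (mul_pos (ha0 i) (ha0 i')).le (sq_nonneg _)
        nlinarith
      rcases exists_project_or_exists_dense (by linarith) B A v u hv hu hvR h01' (fun _ => rfl)
        (fun _ => rfl) (hflipsum ▸ hP) hY with
        ⟨v', A', j₀, hj₀, hv₀, hA', hn, hin, hz, hzz, hm⟩ | ⟨B', hB', hm, hd⟩
      · refine hmove u v' A' B hA' subset_rfl (fun _ => le_rfl) hn (fun i hi j _ => ?_)
          (add_lt_add_of_le_of_lt ?_ (card_filter_ne_zero_lt subset_rfl hj₀ hv₀ hz hzz)) ?_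
        · rw [real_inner_comm, hin j i hi, real_inner_comm]
        · gcongr
        · rwa [mul_comm, mul_comm (expMass _ A' u)]
      · refine hflip A B' subset_rfl hB' ?_ ?_
        · rw [mul_left_comm]
          gcongr
        · rw [mul_comm (expMass _ A u), Finset.sum_comm]
          refine hd.trans (le_of_eq (Finset.sum_congr rfl fun j _ => Finset.sum_congr rfl
            fun i _ => ?_))
          rw [real_inner_comm, mul_comm (Real.exp _) (Real.exp _)]

/-! ### Vectors from the singular value decomposition -/

/-- The singular value decomposition writes the entries of a matrix as inner products of vectors
whose total squared norm, for the rows as for the columns, is the trace norm. -/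
theorem Matrix.exists_inner_eq_and_sum_norm_sq_eq_traceNorm {m n : ℕ}
    (M : Matrix (Fin m) (Fin n) ℝ) :
    ∃ (u : Fin m → EuclideanSpace ℝ (Fin n)) (v : Fin n → EuclideanSpace ℝ (Fin n)),
      (∀ i j, inner ℝ (u i) (v j) = M i j) ∧
      ∑ i, ‖u i‖ ^ 2 = M.traceNorm ∧ ∑ j, ‖v j‖ ^ 2 = M.traceNorm := by
  set T := Matrix.toEuclideanLin M with hT
  have hn : Module.finrank ℝ (EuclideanSpace ℝ (Fin n)) = n := by simp
  set e := T.isSymmetric_adjoint_comp_self.eigenvectorBasis hn with he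
  set σ : Fin n → ℝ := fun k => T.singularValues k with hσ
  have hσ0 : ∀ k, 0 ≤ σ k := fun k => T.singularValues_nonneg k
  have hTe : ∀ k, ‖T (e k)‖ ^ 2 = σ k ^ 2 := by
    intro k
    have h := T.isSymmetric_adjoint_comp_self.apply_eigenvectorBasis hn k
    rw [hσ, T.sq_singularValues_fin hn k, ← real_inner_self_eq_norm_sq,
      ← LinearMap.adjoint_inner_left, ← LinearMap.comp_apply, he, h, inner_smul_left,
      real_inner_self_eq_norm_sq, OrthonormalBasis.norm_eq_one]
    simp
  have htr : ∑ k, σ k = M.traceNorm := by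
    rw [Matrix.traceNorm, hσ, ← Finset.sum_range fun k => T.singularValues k]
    symm
    refine Finset.sum_subset (Finset.range_subset_range.2 (min_le_right m n)) fun k hk hk' => ?_
    rw [Finset.mem_range] at hk hk'
    refine T.singularValues_eq_zero_iff_le_finrank_range.2 ?_
    have h1 := Submodule.finrank_le T.range
    rw [finrank_euclideanSpace, Fintype.card_fin] at h1
    omega
  refine ⟨fun i => WithLp.toLp 2 fun k => T (e k) i / √(σ k),
    fun j => WithLp.toLp 2 fun k => √(σ k) * e k j, fun i j => ?_, ?_, ?_⟩
  · have h1 : T (EuclideanSpace.single j 1) i = M i j := by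
      simp [hT, Matrix.toLpLin_apply]
    have h2 := congrArg (fun z => T z i) (e.sum_repr (EuclideanSpace.single j 1))
    simp only [map_sum, map_smul, WithLp.ofLp_sum, Finset.sum_apply, WithLp.ofLp_smul,
      Pi.smul_apply, smul_eq_mul, OrthonormalBasis.repr_apply_apply,
      EuclideanSpace.inner_single_right, h1] at h2
    rw [← h2, PiLp.inner_apply]
    refine Finset.sum_congr rfl fun k _ => ?_
    by_cases h0 : σ k = 0
    · have h3 : T (e k) = 0 := by
        have := hTe k
        rw [h0] at this
        simpa using this
      simp [h3]
    · have h3 : √(σ k) ≠ 0 := (Real.sqrt_pos.2 (lt_of_le_of_ne (hσ0 k) (Ne.symm h0))).ne'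
      simp
      field_simp
  · simp only [EuclideanSpace.norm_sq_eq, Real.norm_eq_abs, sq_abs, div_pow, Real.sq_sqrt (hσ0 _)]
    rw [Finset.sum_comm, ← htr]
    refine Finset.sum_congr rfl fun k _ => ?_
    have h1 := hTe k
    rw [EuclideanSpace.norm_sq_eq] at h1
    simp only [Real.norm_eq_abs, sq_abs] at h1
    rw [← Finset.sum_div, h1, sq, mul_self_div_self]
  · simp only [EuclideanSpace.norm_sq_eq, Real.norm_eq_abs, sq_abs, mul_pow, Real.sq_sqrt (hσ0 _)]
    rw [Finset.sum_comm, ← htr]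
    refine Finset.sum_congr rfl fun k _ => ?_
    have h1 : ‖e k‖ ^ 2 = 1 := by rw [OrthonormalBasis.norm_eq_one, one_pow]
    rw [EuclideanSpace.norm_sq_eq] at h1
    simp only [Real.norm_eq_abs, sq_abs] at h1
    rw [← Finset.mul_sum, h1, mul_one]

/-- A family of mean squared norm at most `g` has large mass, also after the vectors of squared norm
above `6 g` are discarded. -/
theorem card_mul_exp_div_two_le_expMass {α E : Type*} [Fintype α] [NormedAddCommGroup E] {c g : ℝ}
    (hc : 0 ≤ c) (hcg : 1 ≤ c * g) (u : α → E) (hu : ∑ i, ‖u i‖ ^ 2 ≤ g * Fintype.card α) :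
    Fintype.card α * Real.exp (-(c * g)) / 2 ≤
      expMass c (Finset.univ.filter fun i => ‖u i‖ ^ 2 ≤ 6 * g) u := by
  refine le_trans ?_ (expMass_sub_le_expMass_filter hc Finset.univ u (6 * g))
  have h1 := exp_mul_sum_le_sum_mul_exp Finset.univ (fun _ : α => (1 : ℝ))
    (fun i => -(c * ‖u i‖ ^ 2)) (-(c * g)) (fun _ _ => zero_le_one) (by
      simp only [one_mul, Finset.sum_neg_distrib, ← Finset.mul_sum, Finset.sum_const,
        Finset.card_univ, nsmul_eq_mul, mul_one]
      nlinarith)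
  simp only [one_mul, Finset.sum_const, Finset.card_univ, nsmul_eq_mul, mul_one] at h1
  have h2 : Real.exp (-(c * (6 * g))) ≤ Real.exp (-(c * g)) / 2 := by
    have h3 : Real.exp (-(c * (6 * g))) * Real.exp 1 ≤ Real.exp (-(c * g)) := by
      rw [← Real.exp_add, Real.exp_le_exp]
      linarith
    have h4 := Real.add_one_le_exp (1 : ℝ)
    nlinarith [Real.exp_pos (-(c * (6 * g)))]
  have h5 : (Fintype.card α : ℝ) * Real.exp (-(c * (6 * g))) ≤
      Fintype.card α * (Real.exp (-(c * g)) / 2) := by gcongr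
  rw [Finset.card_univ]
  unfold expMass
  linarith

/-- A Boolean matrix of normalized trace norm at most `g` has a monochromatic submatrix whose area
is a proportion of at least `exp (-576 g ^ 2)`. -/
theorem Matrix.exists_monochromatic_of_traceNorm_le {m n : ℕ} (hm : 0 < m) (hn : 0 < n)
    (M : Matrix (Fin m) (Fin n) ℝ) (hM : M.IsBoolean) {g : ℝ} (hg : 1 ≤ g)
    (hMg : M.normalizedTraceNorm ≤ g) :
    ∃ (A : Finset (Fin m)) (B : Finset (Fin n)),
      ((∀ i ∈ A, ∀ j ∈ B, M i j = 0) ∨ (∀ i ∈ A, ∀ j ∈ B, M i j = 1)) ∧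
      m * n * Real.exp (-(576 * g ^ 2)) ≤ (A.card : ℝ) * B.card := by
  classical
  obtain ⟨u, v, huv, hu, hv⟩ := M.exists_inner_eq_and_sum_norm_sq_eq_traceNorm
  have hm' : (0 : ℝ) < m := by exact_mod_cast hm
  have hn' : (0 : ℝ) < n := by exact_mod_cast hn
  have hsm : 0 < √(m : ℝ) := Real.sqrt_pos.2 hm'
  have hsn : 0 < √(n : ℝ) := Real.sqrt_pos.2 hn'
  have htr : M.traceNorm ≤ g * (√(m : ℝ) * √(n : ℝ)) := by
    rw [Matrix.normalizedTraceNorm, Real.sqrt_mul hm'.le, div_le_iff₀ (by positivity)] at hMg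
    exact hMg
  -- rescale so that row and column vectors have the same bound on the mean squared norm
  set t : ℝ := √(√(m : ℝ) / √(n : ℝ)) with ht
  have ht0 : 0 < t := Real.sqrt_pos.2 (by positivity)
  have ht2 : t ^ 2 = √(m : ℝ) / √(n : ℝ) := Real.sq_sqrt (by positivity)
  have hu' : ∑ i, ‖t • u i‖ ^ 2 ≤ g * Fintype.card (Fin m) := by
    simp only [norm_smul, mul_pow, Real.norm_eq_abs, sq_abs]
    rw [← Finset.mul_sum, hu, ht2, Fintype.card_fin]
    calc √(m : ℝ) / √(n : ℝ) * M.traceNorm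
        ≤ √(m : ℝ) / √(n : ℝ) * (g * (√(m : ℝ) * √(n : ℝ))) := by gcongr
      _ = g * (√(m : ℝ) * √(m : ℝ)) := by field_simp
      _ = g * m := by rw [Real.mul_self_sqrt hm'.le]
  have hv' : ∑ j, ‖t⁻¹ • v j‖ ^ 2 ≤ g * Fintype.card (Fin n) := by
    simp only [norm_smul, mul_pow, Real.norm_eq_abs, sq_abs]
    rw [← Finset.mul_sum, hv, inv_pow, ht2, Fintype.card_fin]
    calc (√(m : ℝ) / √(n : ℝ))⁻¹ * M.traceNorm
        ≤ (√(m : ℝ) / √(n : ℝ))⁻¹ * (g * (√(m : ℝ) * √(n : ℝ))) := by gcongr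
      _ = g * (√(n : ℝ) * √(n : ℝ)) := by field_simp
      _ = g * n := by rw [Real.mul_self_sqrt hn'.le]
  have hc : 0 ≤ 32 * (6 * g) := by linarith
  have hcg : 2 ≤ 32 * (6 * g) * g := by nlinarith
  have hA := card_mul_exp_div_two_le_expMass hc (by linarith) (fun i => t • u i) hu'
  have hB := card_mul_exp_div_two_le_expMass hc (by linarith) (fun j => t⁻¹ • v j) hv'
  set A := Finset.univ.filter fun i => ‖t • u i‖ ^ 2 ≤ 6 * g
  set B := Finset.univ.filter fun j => ‖t⁻¹ • v j‖ ^ 2 ≤ 6 * g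
  have hmass : Fintype.card (Fin m) * Fintype.card (Fin n) * Real.exp (-(16 * (6 * g) ^ 2)) ≤
      expMass (32 * (6 * g)) A (fun i => t • u i) *
        expMass (32 * (6 * g)) B fun j => t⁻¹ • v j := by
    refine le_trans ?_ (mul_le_mul hA hB (by positivity) (expMass_nonneg _ _ _))
    have h1 : Real.exp (-(16 * (6 * g) ^ 2)) =
        Real.exp (-(32 * (6 * g) * g)) ^ 2 * Real.exp (-(32 * (6 * g) * g)) := by
      rw [← pow_succ, ← Real.exp_nat_mul]
      push_cast
      ring_nf
    have h2 : Real.exp (-(32 * (6 * g) * g)) ≤ 1 / 4 := by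
      rw [Real.exp_neg, one_div]
      refine inv_anti₀ (by norm_num) ?_
      have := Real.quadratic_le_exp_of_nonneg (x := 32 * (6 * g) * g) (by linarith)
      nlinarith
    rw [h1]
    calc _ ≤ (Fintype.card (Fin m) : ℝ) * Fintype.card (Fin n) *
          (Real.exp (-(32 * (6 * g) * g)) ^ 2 * (1 / 4)) := by gcongr
      _ = _ := by ring
  have hcard : 0 < (Fintype.card (Fin m) : ℝ) * Fintype.card (Fin n) := by
    rw [Fintype.card_fin, Fintype.card_fin]
    positivity
  have hpos := lt_of_lt_of_le (mul_pos hcard (Real.exp_pos _)) hmass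
  obtain ⟨N, hN⟩ := pow_unbounded_of_one_lt ((Fintype.card (Fin m) : ℝ) * Fintype.card (Fin n) /
    (expMass (32 * (6 * g)) A (fun i => t • u i) *
        expMass (32 * (6 * g)) B fun j => t⁻¹ • v j)) one_lt_two
  rw [div_lt_iff₀ hpos] at hN
  obtain ⟨A', B', hmono, hsize⟩ := exists_monochromatic_of_expMass (R := 6 * g) (by linarith) hcard N
    _ _ M A B (fun i => t • u i) (fun j => t⁻¹ • v j) (fun i _ j _ => hM i j)
    (fun i hi => (Finset.mem_filter.1 hi).2) (fun j hj => (Finset.mem_filter.1 hj).2)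
    (fun i _ j _ => by
      rw [real_inner_smul_left, real_inner_smul_right, huv, mul_inv_cancel_left₀ ht0.ne'])
    le_rfl hmass hN.le
  refine ⟨A', B', hmono, ?_⟩
  rw [Fintype.card_fin, Fintype.card_fin] at hsize
  convert hsize using 4
  ring

/-! ### The density bound -/

theorem corollary1p2 :
    ∃ C : ℝ, 0 < C ∧
      ∀ (m n : ℕ), 0 < m → 0 < n →
      ∀ (M : Matrix (Fin m) (Fin n) ℝ), M.IsBoolean →
      ∀ γ : ℝ, M.normalizedTraceNorm ≤ γ →
        ∃ δ₁ δ₂ : ℝ,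
          (2 : ℝ) ^ (-(C * max 1 γ ^ 3)) ≤ δ₁ ∧ (2 : ℝ) ^ (-(C * max 1 γ ^ 3)) ≤ δ₂ ∧
          ∃ (A : Finset (Fin m)) (B : Finset (Fin n)),
            (A.card : ℝ) = δ₁ * (m : ℝ) ∧ (B.card : ℝ) = δ₂ * (n : ℝ) ∧
            ((∀ i ∈ A, ∀ j ∈ B, M i j = 0) ∨ (∀ i ∈ A, ∀ j ∈ B, M i j = 1)) := by
  refine ⟨1000, by norm_num, fun m n hm hn M hM γ hγ => ?_⟩
  obtain ⟨A, B, hmono, hsize⟩ := M.exists_monochromatic_of_traceNorm_le hm hn hM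
    (le_max_left 1 γ) (hγ.trans (le_max_right 1 γ))
  have hm' : (0 : ℝ) < m := by exact_mod_cast hm
  have hn' : (0 : ℝ) < n := by exact_mod_cast hn
  have hg : 1 ≤ max 1 γ := le_max_left 1 γ
  set g := max 1 γ
  have hexp : (2 : ℝ) ^ (-(1000 * g ^ 3)) ≤ Real.exp (-(576 * g ^ 2)) := by
    rw [Real.rpow_def_of_pos two_pos, Real.exp_le_exp]
    have h1 := Real.log_two_gt_d9
    have h2 : g ^ 2 ≤ g ^ 3 := pow_le_pow_right₀ hg (by norm_num)
    nlinarith [pow_pos (zero_lt_one.trans_le hg) 3]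
  have hAm : (A.card : ℝ) ≤ m := by
    exact_mod_cast A.card_le_univ.trans_eq (Fintype.card_fin m)
  have hBn : (B.card : ℝ) ≤ n := by
    exact_mod_cast B.card_le_univ.trans_eq (Fintype.card_fin n)
  refine ⟨A.card / m, B.card / n, hexp.trans ?_, hexp.trans ?_, A, B,
    (div_mul_cancel₀ _ hm'.ne').symm, (div_mul_cancel₀ _ hn'.ne').symm, hmono⟩
  · rw [le_div_iff₀ hm']
    refine le_of_mul_le_mul_right ?_ hn'
    have := mul_le_mul_of_nonneg_left hBn (Nat.cast_nonneg (α := ℝ) A.card)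
    linarith
  · rw [le_div_iff₀ hn']
    refine le_of_mul_le_mul_left ?_ hm'
    have := mul_le_mul_of_nonneg_right hAm (Nat.cast_nonneg (α := ℝ) B.card)
    linarith
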